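/- \textbf{Setting.} Let $K$ be a field with decidable equality. Let $\alpha$ be a set of (abstract) power-products with decidable equality: a cancellative commutative monoid with exact division of multiples, least common multiples, in which $st=1$ implies $s=1$, and which admits a Dickson grading, i.e. a map $d:\alpha\to\mathbb N$ with $d(st)=\max(d(s),d(t))$ such that every infinite sequence of elements of grade at most $n$ contains $s_i\mid s_j$ with $i<j$, for each $n$. (For instance, the power-products in finitely or countably many indeterminates.) Let $\kappa$ be a non-empty well-ordered set of component indices. A term is a pair $s\,e_i$ with $s\in\alpha$, $i\in\kappa$, and $t\cdot(s\,e_i)=(ts)\,e_i$; $s\,e_i$ divides $t\,e_j$ iff $i=j$ and $s\mid t$. A polynomial is a finitely supported map from terms to $K$. Let $\preceq$ be a linear order on $\alpha$ with $1\preceq t$ and $s\preceq t\Rightarrow su\preceq tu$, and let $\preceq_{\mathsf t}$ be a linear order on terms with $v\preceq_{\mathsf t}w\Rightarrow t\cdot v\preceq_{\mathsf t}t\cdot w$, and with $s\,e_i\preceq_{\mathsf t}t\,e_j$ whenever $s\preceq t$ and $i\le j$. For $p\ne0$ let $\mathrm{lt}(p)=\mathrm{lp}(p)\,e_i$ be the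 $\preceq_{\mathsf t}$-largest term of $p$, $\mathrm{lc}(p)$ its coefficient, and $\mathrm{tail}(p)=p-\mathrm{lc}(p)\,\mathrm{lt}(p)$; by convention $\mathrm{lt}(0)$ is the smallest term, $\mathrm{lc}(0)=0$ and $1/0=0$ in $K$. For a set $F$ of polynomials, $\mathrm{pmdl}(F)$ is the smallest set that contains $F\cup\{0\}$ and is closed under addition and under multiplication by elements of $K$ and of $\alpha$. Write $p\to_F q$ if $q=p-\frac{c}{\mathrm{lc}(f)}\,t\,f$ for some non-zero $f\in F$ and some $t\in\alpha$ such that the coefficient $c$ of $t\cdot\mathrm{lt}(f)$ in $p$ is non-zero. A normal form of $p$ modulo $F$ is a $\to_F$-irreducible $r$ with $p\to_F^*r$; $F$ is a Gröbner basis if $\to_F$ is confluent. A list is identified with the set of its elements where a set is expected. \textbf{Algorithms.} $\mathrm{trd}(fs,p)$ (total reduction): start with $r=0$; while $p\neq0$, take the first non-zero $f$ in the list $fs$ such that $\mathrm{lt}(f)$ divides $\mathrm{lt}(p)$ and replace $p$ by $\mathrm{tail}(p)-\frac{\mathrm{lc}(p)}{\mathrm{lc}(f)}\frac{\mathrm{lp}(p)}{\mathrm{lp}(f)}\,\mathrm{tail}(f)$;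 if there is no such $f$, add $\mathrm{lc}(p)\,\mathrm{lt}(p)$ to $r$ and replace $p$ by $\mathrm{tail}(p)$. When $p=0$, return $r$. $\mathrm{spoly}(p,q)$ is $\frac{l}{\mathrm{lc}(p)\,\mathrm{lp}(p)}p-\frac{l}{\mathrm{lc}(q)\,\mathrm{lp}(q)}q$ with $l=\mathrm{lcm}(\mathrm{lp}(p),\mathrm{lp}(q))$ if $\mathrm{lt}(p)$ and $\mathrm{lt}(q)$ have the same component index, and $0$ otherwise. $\mathrm{gb}(fs)$ (Buchberger's algorithm): start with the list $bs=fs$ and with a list $ps$ containing one pair for every two distinct elements of $fs$. While $ps$ is non-empty and it is not the case that for every component index $i$ occurring in $bs$ there is a non-zero $b\in bs$ with $\mathrm{lt}(b)=1\,e_i$: select a pair $(p,q)$ from $ps$, remove it from $ps$, and compute $h=\mathrm{trd}(bs,\mathrm{spoly}(p,q))$; if $h\neq0$, add all pairs $(h,b)$, $b\in bs$, to $ps$ and append $h$ to $bs$. Finally return $bs$. The function that selects one element of $ps$, depending on $bs$ and $ps$, is arbitrary. \textbf{Theorem (submodule membership via gb).} Let $fs$ be a finite list of polynomials. For every selection function,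 $\mathrm{gb}(fs)$ terminates, and its result is a Gröbner basis with $\mathrm{pmdl}(\mathrm{gb}(fs))=\mathrm{pmdl}(fs)$. For every polynomial $p$, $\mathrm{trd}(\mathrm{gb}(fs),p)$ terminates, its result is a normal form of $p$ modulo $\mathrm{gb}(fs)$, and \[ p\in\mathrm{pmdl}(fs)\iff \mathrm{trd}(\mathrm{gb}(fs),p)=0. \] Consequently the procedure that computes $\mathrm{gb}(fs)$, then $\mathrm{trd}(\mathrm{gb}(fs),p)$, and tests the result for $0$ is a decision procedure for submodule membership (relative to the basic operations of $K$, $\alpha$, $\kappa$, the orders and the selection function): it terminates on every input $(fs,p)$ and answers "true" if and only if $p\in\mathrm{pmdl}(fs)$. -/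

import Mathlib

/-- A Dickson grading: `d (s * t) = max (d s) (d t)`, and for every `n` divisibility is almost full
on `{t | d t ≤ n}`, i.e. every sequence of elements of grade at most `n` has an entry dividing a
later one. -/
def IsDicksonGrading {α : Type*} [Monoid α] (d : α → ℕ) : Prop :=
  (∀ s t : α, d (s * t) = max (d s) (d t)) ∧
    ∀ (n : ℕ) (s : ℕ → α), (∀ i, d (s i) ≤ n) → ∃ i j, i < j ∧ s i ∣ s j

/-- Abstract power-products: a cancellative commutative monoid with least common multiples, without
non-trivial units, and admitting a Dickson grading. As for every cancellative commutative monoid,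
there is a division operation that is exact on multiples (its other values are irrelevant). -/
class GradedDicksonPowerprod (α : Type*) extends CancelCommMonoid α, Div α where
  mul_div_cancel_left_pp : ∀ s t : α, (s * t) / s = t
  /-- The least common multiple. -/
  lcm : α → α → α
  dvd_lcm : ∀ s t : α, s ∣ lcm s t
  lcm_dvd : ∀ s t u : α, s ∣ u → t ∣ u → lcm s t ∣ u
  lcm_comm : ∀ s t : α, lcm s t = lcm t s
  times_eq_one : ∀ s t : α, s * t = 1 → s = 1
  ex_dgrad : ∃ d : α → ℕ, IsDicksonGrading d

namespace GroebnerBases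

variable {α κ β : Type*}

/-- Terms are pairs of a power-product and a component index; `stimes t v` multiplies the
power-product of `v` by `t`. -/
def stimes [Mul α] (t : α) (v : α × κ) : α × κ := (t * v.1, v.2)

/-- Divisibility of terms: `s e_i` divides `t e_j` iff `i = j` and `s` divides `t`. -/
def TermDvd [GradedDicksonPowerprod α] (v w : α × κ) : Prop := v.2 = w.2 ∧ v.1 ∣ w.1

theorem dvd_iff_mul_div [GradedDicksonPowerprod α] (s t : α) : s ∣ t ↔ s * (t / s) = t := by
  constructor
  · rintro ⟨u, rfl⟩
    rw [GradedDicksonPowerprod.mul_div_cancel_left_pp]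
  · intro h
    exact ⟨t / s, h.symm⟩

instance [GradedDicksonPowerprod α] [DecidableEq α] [DecidableEq κ] (v w : α × κ) :
    Decidable (TermDvd v w) :=
  decidable_of_iff (v.2 = w.2 ∧ v.1 * (w.1 / v.1) = w.1)
    (and_congr_right fun _ => (dvd_iff_mul_div v.1 w.1).symm)

/-- Vector-polynomials: finitely supported maps from terms to coefficients. (`DFinsupp` rather than
`Finsupp`, so that the algorithms below are executable.) -/
abbrev VecPoly (α κ β : Type*) [Zero β] : Type _ := DFinsupp fun _ : α × κ => β

/-- An admissible order on power-products together with an admissible extension to terms. -/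
structure TermOrder (α κ : Type*) [GradedDicksonPowerprod α] [LinearOrder κ] where
  /-- The order on power-products. -/
  ord : LinearOrder α
  one_min : ∀ t : α, ord.le 1 t
  times_mono : ∀ s t u : α, ord.le s t → ord.le (s * u) (t * u)
  /-- The order on terms. -/
  ordTerm : LinearOrder (α × κ)
  stimes_mono : ∀ (v w : α × κ) (t : α), ordTerm.le v w → ordTerm.le (stimes t v) (stimes t w)
  ord_termI : ∀ v w : α × κ, ord.le v.1 w.1 → v.2 ≤ w.2 → ordTerm.le v w

variable [GradedDicksonPowerprod α] [DecidableEq α] [LinearOrder κ] [OrderBot κ]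
  [Field β] [DecidableEq β]

/-- Multiplication by a coefficient `c` and a power-product `t`. -/
def monomMult (c : β) (t : α) (p : VecPoly α κ β) : VecPoly α κ β :=
  ∑ v ∈ p.support, DFinsupp.single (stimes t v) (c * p v)

/-- The submodule generated by `B`: the smallest set containing `B ∪ {0}` that is closed under
addition and under multiplication by coefficients and power-products. -/
inductive InPmdl (B : Set (VecPoly α κ β)) : VecPoly α κ β → Prop
  | base (b : VecPoly α κ β) (hb : b ∈ B) : InPmdl B b
  | zero : InPmdl B 0
  | add (p q : VecPoly α κ β) (hp : InPmdl B p) (hq : InPmdl B q) : InPmdl B (p + q)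
  | monom (c : β) (t : α) (p : VecPoly α κ β) (hp : InPmdl B p) : InPmdl B (monomMult c t p)

/-- The submodule generated by `B`, as a set. -/
def pmdl (B : Set (VecPoly α κ β)) : Set (VecPoly α κ β) := {p | InPmdl B p}

namespace TermOrder

variable (o : TermOrder α κ)

/-- The leading term; by convention the smallest term if `p = 0`. -/
def lt (p : VecPoly α κ β) : α × κ :=
  if h : p.support.Nonempty then @Finset.max' _ o.ordTerm p.support h else (1, ⊥)

/-- The leading power-product. -/
def lp (p : VecPoly α κ β) : α := (o.lt p).1

/-- The leading coefficient (`0` if `p = 0`). -/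
def lc (p : VecPoly α κ β) : β := p (o.lt p)

/-- The tail: `p` without its leading monomial. -/
def tail (p : VecPoly α κ β) : VecPoly α κ β := p.erase (o.lt p)

/-! ### Reduction and Gröbner bases -/

/-- `p` reduces to `q` modulo `f` using `t`. -/
def RedSingle (p q f : VecPoly α κ β) (t : α) : Prop :=
  f ≠ 0 ∧ p (stimes t (o.lt f)) ≠ 0 ∧
    q = p - monomMult (p (stimes t (o.lt f)) / o.lc f) t f

/-- `p` reduces to `q` modulo the set `F` in one step. -/
def Red (F : Set (VecPoly α κ β)) (p q : VecPoly α κ β) : Prop :=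
  ∃ f ∈ F, ∃ t, o.RedSingle p q f t

/-- `q` is a normal form of `p` modulo `F`. -/
def IsNormalForm (F : Set (VecPoly α κ β)) (p q : VecPoly α κ β) : Prop :=
  Relation.ReflTransGen (o.Red F) p q ∧ ¬ ∃ q', o.Red F q q'

/-- `G` is a Gröbner basis: reduction modulo `G` is confluent. -/
def IsGB (G : Set (VecPoly α κ β)) : Prop :=
  ∀ a b c : VecPoly α κ β,
    Relation.ReflTransGen (o.Red G) a b → Relation.ReflTransGen (o.Red G) a c →
      ∃ d, Relation.ReflTransGen (o.Red G) b d ∧ Relation.ReflTransGen (o.Red G) c d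

/-! ### The algorithms

They are executable. General recursion takes values in `Option`: the value is `some x` if the
computation terminates with result `x`, and `none` if it runs forever. -/

/-- The first non-zero `f` in the list whose leading term divides `v`. -/
def findDvd : List (VecPoly α κ β) → α × κ → Option (VecPoly α κ β)
  | [], _ => none
  | f :: fs, v => if f ≠ 0 ∧ TermDvd (o.lt f) v then some f else findDvd fs v

/-- Total reduction with accumulator `r`: the terms are processed from the greatest one downwards,
irreducible ones being moved to `r`. -/
def trdAux (fs : List (VecPoly α κ β)) (p r : VecPoly α κ β) : Option (VecPoly α κ β) :=
  if p = 0 then some r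
  else
    match o.findDvd fs (o.lt p) with
    | none => trdAux fs (o.tail p) (r + DFinsupp.single (o.lt p) (o.lc p))
    | some f =>
      trdAux fs (o.tail p - monomMult (o.lc p / o.lc f) (o.lp p / o.lp f) (o.tail f)) r
  partial_fixpoint

/-- Total reduction of `p` modulo the list `fs`. -/
def trd (fs : List (VecPoly α κ β)) (p : VecPoly α κ β) : Option (VecPoly α κ β) :=
  o.trdAux fs p 0

/-- The S-polynomial. -/
def spoly (p q : VecPoly α κ β) : VecPoly α κ β :=
  if (o.lt p).2 = (o.lt q).2 then
    let l := GradedDicksonPowerprod.lcm (o.lp p) (o.lp q)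
    monomMult (1 / o.lc p) (l / o.lp p) p - monomMult (1 / o.lc q) (l / o.lp q) q
  else 0

/-- Does every component index `i` occurring in `bs` have a non-zero `b` in `bs` with leading term
`1 e_i`? -/
def genWholeModule (bs : List (VecPoly α κ β)) : Bool :=
  bs.all fun a => decide (∀ v ∈ a.support, ∃ b ∈ bs, b ≠ 0 ∧ o.lt b = (1, v.2))

end TermOrder

/-- All pairs of elements at different positions of a list, in the order of the list. -/
def listPairs {γ : Type*} : List γ → List (γ × γ)
  | [] => []
  | h :: hs => hs.map (fun g => (h, g)) ++ listPairs hs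

/-- The pairs in `ps`, the pairs `(h, b)` for `h` in `hs` and `b` in `bs`, and one of the pairs
`(h₁, h₂)`, `(h₂, h₁)` for all distinct `h₁`, `h₂` in `hs`. -/
def addPairs {γ : Type*} [DecidableEq γ] (bs : List γ) (ps : List (γ × γ)) (hs : List γ) :
    List (γ × γ) :=
  ps ++ hs.product bs ++ listPairs hs.dedup

/-- `diffList xs ys` removes all occurrences of all elements of `ys` from `xs`. -/
def diffList {γ : Type*} [DecidableEq γ] (xs ys : List γ) : List γ :=
  xs.filter fun x => decide (x ∉ ys)

/-- `sel` selects a single pair: if `ps` is non-empty, `sel bs ps` is a one-element list whose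
element belongs to `ps`. -/
def SelectsSinglePair {γ : Type*} (sel : List γ → List (γ × γ) → List (γ × γ)) : Prop :=
  ∀ bs ps, ps ≠ [] → ∃ x ∈ ps, sel bs ps = [x]

namespace TermOrder

variable (o : TermOrder α κ)

/-- The algorithm schema: `bs` is the current basis, `ps` the list of pairs still to be
considered. -/
def gbSchemaAux
    (sel : List (VecPoly α κ β) → List (VecPoly α κ β × VecPoly α κ β) →
      List (VecPoly α κ β × VecPoly α κ β))
    (compl : List (VecPoly α κ β) → List (VecPoly α κ β × VecPoly α κ β) →
      List (VecPoly α κ β × VecPoly α κ β) → Option (List (VecPoly α κ β)))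
    (bs : List (VecPoly α κ β)) (ps : List (VecPoly α κ β × VecPoly α κ β)) :
    Option (List (VecPoly α κ β)) :=
  if ps = [] ∨ o.genWholeModule bs = true then some bs
  else do
    let hs ← compl bs (diffList ps (sel bs ps)) (sel bs ps)
    gbSchemaAux sel compl (bs ++ hs) (addPairs bs (diffList ps (sel bs ps)) hs)
  partial_fixpoint

/-- The algorithm schema with the right initial values. -/
def gbSchema
    (sel : List (VecPoly α κ β) → List (VecPoly α κ β × VecPoly α κ β) →
      List (VecPoly α κ β × VecPoly α κ β))
    (compl : List (VecPoly α κ β) → List (VecPoly α κ β × VecPoly α κ β) →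
      List (VecPoly α κ β × VecPoly α κ β) → Option (List (VecPoly α κ β)))
    (fs : List (VecPoly α κ β)) : Option (List (VecPoly α κ β)) :=
  o.gbSchemaAux sel compl fs (addPairs [] [] fs)

/-- The completion step of Buchberger's algorithm: the S-polynomial of the selected pair is totally
reduced modulo `bs`, and the result is returned if it is non-zero. -/
def gbRed (bs : List (VecPoly α κ β)) (_ps : List (VecPoly α κ β × VecPoly α κ β)) :
    List (VecPoly α κ β × VecPoly α κ β) → Option (List (VecPoly α κ β))
  | [] => some []
  | (p, q) :: _ => (o.trd bs (o.spoly p q)).map fun h => if h = 0 then [] else [h]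

/-- Buchberger's algorithm with selection strategy `sel`. -/
def gb
    (sel : List (VecPoly α κ β) → List (VecPoly α κ β × VecPoly α κ β) →
      List (VecPoly α κ β × VecPoly α κ β))
    (fs : List (VecPoly α κ β)) : Option (List (VecPoly α κ β)) :=
  o.gbSchema sel o.gbRed fs

/-- The membership test: compute a Gröbner basis, totally reduce `p` modulo it, and check whether
the result is `0`. -/
def memTest
    (sel : List (VecPoly α κ β) → List (VecPoly α κ β × VecPoly α κ β) →
      List (VecPoly α κ β × VecPoly α κ β))
    (fs : List (VecPoly α κ β)) (p : VecPoly α κ β) : Option Bool :=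
  (o.gb sel fs).bind fun G => (o.trd G p).map fun r => decide (r = 0)

end TermOrder

end GroebnerBases

/-!
Every finite set of terms is contained in the set `S` of all terms of bounded grade with components
in some finite set (`IsDicksonDomain`). On `S` divisibility is a well-quasi-order, so the term
order, which extends divisibility, is well-founded on `S`; and reductions and S-polynomials of
polynomials with terms in `S` stay in `S`. This makes total reduction terminate, and also
Buchberger's algorithm, because each new basis element has a leading term in `S` that no earlier
leading term divides.

For correctness, call `p` representable with terms in `T` if it is a combination of multiples `t g`
of basis elements with `t lt(g)` in `T`. Reducing an S-polynomial to a basis element represents it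
strictly below the least common multiple of the two leading terms. By Buchberger's criterion, this
forces the leading term of every non-zero `p` in the submodule to be reducible: in a representation
of `p` whose greatest term `u` is as small as possible, either the multiples with leading term `u`
add up to a polynomial with leading term `u`, or they are combinations of S-polynomials and can be
replaced by smaller ones.
-/

namespace IsDicksonGrading

theorem le_of_dvd {α : Type*} [Monoid α] {d : α → ℕ} (hd : IsDicksonGrading d) {s t : α}
    (h : s ∣ t) : d s ≤ d t := by
  obtain ⟨u, rfl⟩ := h
  exact (le_max_left _ _).trans_eq (hd.1 s u).symm

theorem partiallyWellOrderedOn {α : Type*} [Monoid α] {d : α → ℕ} (hd : IsDicksonGrading d)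
    (n : ℕ) : {t : α | d t ≤ n}.PartiallyWellOrderedOn (· ∣ ·) :=
  Set.partiallyWellOrderedOn_iff_exists_lt.2 fun f hf => hd.2 n f hf

theorem lcm_le_max {α : Type*} [GradedDicksonPowerprod α] {d : α → ℕ} (hd : IsDicksonGrading d)
    (s t : α) : d (GradedDicksonPowerprod.lcm s t) ≤ max (d s) (d t) := by
  rw [← hd.1]
  exact hd.le_of_dvd
    (GradedDicksonPowerprod.lcm_dvd _ _ _ (dvd_mul_right _ _) (dvd_mul_left _ _))

end IsDicksonGrading

namespace GroebnerBases

section Terms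

variable {α κ : Type*}

theorem stimes_injective [Mul α] [IsLeftCancelMul α] (t : α) :
    Function.Injective (stimes t : α × κ → α × κ) := fun _ _ h =>
  Prod.ext (mul_left_cancel (congrArg Prod.fst h)) (congrArg Prod.snd h :)

theorem stimes_left_injective [Mul α] [IsRightCancelMul α] (v : α × κ) :
    Function.Injective fun t => stimes t v := fun _ _ h =>
  mul_right_cancel (congrArg Prod.fst h)

theorem stimes_stimes [Semigroup α] (s t : α) (v : α × κ) :
    stimes s (stimes t v) = stimes (s * t) v :=
  Prod.ext (mul_assoc s t v.1).symm rfl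

theorem one_stimes [MulOneClass α] (v : α × κ) : stimes 1 v = v :=
  Prod.ext (one_mul v.1) rfl

variable [GradedDicksonPowerprod α] {v w u : α × κ}

theorem termDvd_stimes (t : α) (v : α × κ) : TermDvd v (stimes t v) :=
  ⟨rfl, dvd_mul_left v.1 t⟩

theorem TermDvd.stimes_div (h : TermDvd v w) : stimes (w.1 / v.1) v = w :=
  Prod.ext ((mul_comm _ _).trans ((dvd_iff_mul_div v.1 w.1).1 h.2)) h.1

/-- The least common multiple of two terms with the same component; its value for terms with
different components is irrelevant. -/
def lcmTerm (v w : α × κ) : α × κ := (GradedDicksonPowerprod.lcm v.1 w.1, v.2)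

theorem termDvd_lcmTerm_left (v w : α × κ) : TermDvd v (lcmTerm v w) :=
  ⟨rfl, GradedDicksonPowerprod.dvd_lcm v.1 w.1⟩

theorem lcmTerm_comm (h : v.2 = w.2) : lcmTerm v w = lcmTerm w v :=
  Prod.ext (GradedDicksonPowerprod.lcm_comm v.1 w.1) h

theorem termDvd_lcmTerm_right (h : v.2 = w.2) : TermDvd w (lcmTerm v w) :=
  lcmTerm_comm h ▸ termDvd_lcmTerm_left w v

theorem lcmTerm_dvd (hv : TermDvd v u) (hw : TermDvd w u) : TermDvd (lcmTerm v w) u :=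
  ⟨hv.1, GradedDicksonPowerprod.lcm_dvd _ _ _ hv.2 hw.2⟩

/-- A set of terms on which divisibility is a well-quasi-order, and in which reductions and
S-polynomials of polynomials with terms in the set can be carried out. -/
structure IsDicksonDomain (S : Set (α × κ)) : Prop where
  partiallyWellOrderedOn : S.PartiallyWellOrderedOn TermDvd
  stimes_mem : ∀ ⦃t v w⦄, stimes t v ∈ S → w ∈ S → stimes t w ∈ S
  lcmTerm_mem : ∀ ⦃v w⦄, v ∈ S → w ∈ S → lcmTerm v w ∈ S

theorem isDicksonDomain_grade_le {d : α → ℕ} (hd : IsDicksonGrading d) (n : ℕ) {C : Set κ}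
    (hC : C.Finite) : IsDicksonDomain ({s | d s ≤ n} ×ˢ C) where
  partiallyWellOrderedOn := by
    have : IsPreorder α (· ∣ ·) := { refl := dvd_refl, trans := fun _ _ _ => dvd_trans }
    have hprod := (hd.partiallyWellOrderedOn n).prod (hC.partiallyWellOrderedOn (r := (· = ·)))
    refine Set.partiallyWellOrderedOn_iff_exists_lt.2 fun f hf => ?_
    obtain ⟨i, j, hij, hdvd, hcomp⟩ := hprod.exists_lt hf
    exact ⟨i, j, hij, hcomp, hdvd⟩
  stimes_mem t v w hv hw :=
    ⟨(hd.1 t w.1).trans_le (max_le ((hd.le_of_dvd (dvd_mul_right t v.1)).trans hv.1) hw.1), hw.2⟩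
  lcmTerm_mem v w hv hw := ⟨(hd.lcm_le_max v.1 w.1).trans (max_le hv.1 hw.1), hv.2⟩

theorem exists_isDicksonDomain_superset {A : Set (α × κ)} (hA : A.Finite) :
    ∃ S, IsDicksonDomain S ∧ A ⊆ S := by
  obtain ⟨d, hd⟩ := GradedDicksonPowerprod.ex_dgrad (α := α)
  obtain ⟨n, hn⟩ := (hA.image fun v => d v.1).bddAbove
  exact ⟨_, isDicksonDomain_grade_le hd n (hA.image Prod.snd), fun v hv =>
    ⟨hn (Set.mem_image_of_mem _ hv), Set.mem_image_of_mem _ hv⟩⟩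

namespace TermOrder

variable [LinearOrder κ] (o : TermOrder α κ)

theorem stimes_strictMono (t : α) (h : o.ordTerm.lt v w) :
    o.ordTerm.lt (stimes t v) (stimes t w) := by
  let _ := o.ordTerm
  exact (o.stimes_mono v w t h.le).lt_of_ne fun e => h.ne (stimes_injective t e)

theorem ordTerm_le_of_termDvd (h : TermDvd v w) : o.ordTerm.le v w := by
  obtain ⟨hcomp, t, ht⟩ := h
  refine o.ord_termI v w ?_ hcomp.le
  simpa only [one_mul, mul_comm t, ← ht] using o.times_mono 1 t v.1 (o.one_min t)

theorem wellFoundedOn_ordTerm_lt {S : Set (α × κ)} (hS : IsDicksonDomain S) :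
    S.WellFoundedOn o.ordTerm.lt := by
  let _ := o.ordTerm
  refine Set.wellFoundedOn_iff_no_descending_seq.2 fun f hf => ?_
  obtain ⟨i, j, hij, hdvd⟩ := hS.partiallyWellOrderedOn.exists_lt hf
  exact (o.ordTerm_le_of_termDvd hdvd).not_gt (f.map_rel_iff.2 hij)

/-- The terms smaller than `u`. -/
def below (u : α × κ) : Set (α × κ) := {v | o.ordTerm.lt v u}

/-- The terms smaller than or equal to `u`. -/
def atMost (u : α × κ) : Set (α × κ) := {v | o.ordTerm.le v u}

theorem self_notMem_below (u : α × κ) : u ∉ o.below u := by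
  let _ := o.ordTerm
  exact lt_irrefl u

theorem below_subset_atMost (u : α × κ) : o.below u ⊆ o.atMost u := by
  let _ := o.ordTerm
  exact fun _ h => le_of_lt h

end TermOrder

end Terms

section Supported

variable {α κ : Type*} (β : Type*) [Semiring β]

/-- The polynomials all of whose terms lie in `S`. -/
def supported (S : Set (α × κ)) : Submodule β (VecPoly α κ β) where
  carrier := {p | ∀ v, p v ≠ 0 → v ∈ S}
  add_mem' {p q} hp hq v hv := by
    by_cases h : p v = 0
    · exact hq v fun h' => hv (by simp [h, h'])
    · exact hp v h
  zero_mem' v hv := absurd rfl hv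
  smul_mem' c p hp v hv := hp v fun h => hv (by simp [h])

variable {β}

theorem apply_eq_zero_of_mem_supported {S : Set (α × κ)} {p : VecPoly α κ β} {v : α × κ}
    (hp : p ∈ supported β S) (hv : v ∉ S) : p v = 0 :=
  of_not_not (mt (hp v) hv)

theorem supported_mono {S T : Set (α × κ)} (h : S ⊆ T) : supported β S ≤ supported β T :=
  fun _ hp v hv => h (hp v hv)

theorem exists_isDicksonDomain_forall_mem_supported [GradedDicksonPowerprod α]
    {F : Set (VecPoly α κ β)} (hF : F.Finite) :
    ∃ S, IsDicksonDomain S ∧ ∀ f ∈ F, f ∈ supported β S := by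
  obtain ⟨S, hS, hsub⟩ := exists_isDicksonDomain_superset
    (hF.biUnion fun f _ => DFinsupp.finite_support f)
  exact ⟨S, hS, fun f hf v hv => hsub (Set.mem_biUnion hf hv)⟩

end Supported

section Multiplication

variable {α κ β : Type*} [GradedDicksonPowerprod α] [DecidableEq α] [LinearOrder κ]
  [Field β] [DecidableEq β] {c : β} {t : α} {p q : VecPoly α κ β}

theorem monomMult_apply_stimes (c : β) (t : α) (p : VecPoly α κ β) (v : α × κ) :
    monomMult c t p (stimes t v) = c * p v := by
  rw [monomMult, DFinsupp.finsetSum_apply, Finset.sum_eq_single v]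
  · exact DFinsupp.single_eq_same
  · intro w _ hw
    exact DFinsupp.single_eq_of_ne fun h => hw (stimes_injective t h.symm)
  · intro hv
    rw [DFinsupp.notMem_support_iff.1 hv, mul_zero, DFinsupp.single_zero, DFinsupp.zero_apply]

theorem exists_of_monomMult_apply_ne_zero {w : α × κ} (h : monomMult c t p w ≠ 0) :
    ∃ v, w = stimes t v ∧ p v ≠ 0 := by
  rw [monomMult, DFinsupp.finsetSum_apply] at h
  obtain ⟨v, hv, hne⟩ := Finset.exists_ne_zero_of_sum_ne_zero h
  refine ⟨v, by_contra fun hw => hne (DFinsupp.single_eq_of_ne hw), ?_⟩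
  exact DFinsupp.mem_support_iff.1 hv

theorem monomMult_mem_supported {S T : Set (α × κ)} (hp : p ∈ supported β S)
    (h : ∀ v ∈ S, stimes t v ∈ T) : monomMult c t p ∈ supported β T := by
  intro w hw
  obtain ⟨v, rfl, hv⟩ := exists_of_monomMult_apply_ne_zero hw
  exact h v (hp v hv)

theorem monomMult_mem_supported_range (c : β) (t : α) (p : VecPoly α κ β) :
    monomMult c t p ∈ supported β (Set.range (stimes t)) :=
  monomMult_mem_supported (S := Set.univ) (fun _ _ => trivial) fun v _ => ⟨v, rfl⟩

theorem monomMult_eq_of_forall (h : ∀ v, q (stimes t v) = c * p v)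
    (hq : q ∈ supported β (Set.range (stimes t))) : monomMult c t p = q := by
  refine sub_eq_zero.1 (by_contra fun hne => ?_)
  obtain ⟨w, hw⟩ := DFunLike.ne_iff.1 hne
  obtain ⟨v, rfl⟩ := sub_mem (monomMult_mem_supported_range c t p) hq w hw
  exact hw (by rw [DFinsupp.sub_apply, monomMult_apply_stimes, h, sub_self, DFinsupp.zero_apply])

/-- Multiplication by a coefficient and a power-product, as a linear map. -/
def monomMultLinear (c : β) (t : α) : VecPoly α κ β →ₗ[β] VecPoly α κ β where
  toFun := monomMult c t
  map_add' p q := monomMult_eq_of_forall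
    (fun v => by simp only [DFinsupp.add_apply, monomMult_apply_stimes, mul_add])
    (add_mem (monomMult_mem_supported_range c t p) (monomMult_mem_supported_range c t q))
  map_smul' a p := monomMult_eq_of_forall
    (fun v => by simp only [DFinsupp.smul_apply, smul_eq_mul, monomMult_apply_stimes,
      RingHom.id_apply, mul_left_comm])
    (Submodule.smul_mem _ a (monomMult_mem_supported_range c t p))

theorem monomMult_sub (c : β) (t : α) (p q : VecPoly α κ β) :
    monomMult c t (p - q) = monomMult c t p - monomMult c t q :=
  map_sub (monomMultLinear c t) p q

theorem monomMult_eq_smul (c : β) (t : α) (p : VecPoly α κ β) :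
    monomMult c t p = c • monomMult 1 t p :=
  monomMult_eq_of_forall (fun v => by simp [monomMult_apply_stimes])
    (Submodule.smul_mem _ c (monomMult_mem_supported_range 1 t p))

theorem monomMult_monomMult (a c : β) (s t : α) (p : VecPoly α κ β) :
    monomMult a s (monomMult c t p) = monomMult (a * c) (s * t) p := by
  refine (monomMult_eq_of_forall (fun v => ?_) fun w hw => ?_).symm
  · rw [← stimes_stimes, monomMult_apply_stimes, monomMult_apply_stimes, mul_assoc]
  · obtain ⟨v, rfl, hv⟩ := exists_of_monomMult_apply_ne_zero hw
    obtain ⟨u, rfl, -⟩ := exists_of_monomMult_apply_ne_zero hv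
    exact ⟨u, (stimes_stimes s t u).symm⟩

theorem monomMult_one_right (c : β) (p : VecPoly α κ β) : monomMult c 1 p = c • p :=
  monomMult_eq_of_forall (fun v => by simp [one_stimes]) fun w _ => ⟨w, one_stimes w⟩

theorem monomMult_single (c a : β) (t : α) (v : α × κ) :
    monomMult c t (DFinsupp.single v a : VecPoly α κ β) = DFinsupp.single (stimes t v) (c * a) := by
  refine monomMult_eq_of_forall (fun w => ?_) fun w hw => ?_
  · simp [DFinsupp.single_apply, (stimes_injective t).eq_iff]
  · exact ⟨v, by_contra fun h => hw (DFinsupp.single_eq_of_ne (Ne.symm h))⟩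

/-- The set `pmdl F` as a `β`-submodule. -/
def pmdlSubmodule (F : Set (VecPoly α κ β)) : Submodule β (VecPoly α κ β) where
  carrier := pmdl F
  add_mem' hp hq := .add _ _ hp hq
  zero_mem' := .zero
  smul_mem' c p hp := monomMult_one_right c p ▸ InPmdl.monom c 1 p hp

theorem mem_pmdlSubmodule {F : Set (VecPoly α κ β)} : p ∈ pmdlSubmodule F ↔ p ∈ pmdl F :=
  Iff.rfl

theorem pmdl_subset_of_subset_pmdl {F G : Set (VecPoly α κ β)} (h : F ⊆ pmdl G) :
    pmdl F ⊆ pmdl G := by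
  intro p hp
  induction hp with
  | base f hf => exact h hf
  | zero => exact .zero
  | add p q _ _ hp hq => exact .add p q hp hq
  | monom c t p _ hp => exact .monom c t p hp

theorem pmdl_mono {F G : Set (VecPoly α κ β)} (h : F ⊆ G) : pmdl F ⊆ pmdl G :=
  pmdl_subset_of_subset_pmdl fun f hf => .base f (h hf)

theorem pmdl_insert {F : Set (VecPoly α κ β)} (hp : p ∈ pmdl F) : pmdl (insert p F) = pmdl F :=
  (pmdl_subset_of_subset_pmdl (Set.insert_subset hp fun f hf => .base f hf)).antisymm
    (pmdl_mono (Set.subset_insert p F))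

theorem exists_component_of_mem_pmdl {F : Set (VecPoly α κ β)} (hp : p ∈ pmdl F) {v : α × κ}
    (hv : p v ≠ 0) : ∃ f ∈ F, ∃ w, f w ≠ 0 ∧ w.2 = v.2 := by
  induction hp generalizing v with
  | base f hf => exact ⟨f, hf, v, hv, rfl⟩
  | zero => exact absurd rfl hv
  | add p q _ _ hp hq =>
    by_cases h : p v = 0
    · exact hq (by simpa [h] using hv)
    · exact hp h
  | monom c t p _ hp =>
    obtain ⟨w, rfl, hw⟩ := exists_of_monomMult_apply_ne_zero hv
    exact (hp hw :)

end Multiplication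

namespace TermOrder

variable {α κ β : Type*} [GradedDicksonPowerprod α] [DecidableEq α] [LinearOrder κ] [OrderBot κ]
  [Field β] [DecidableEq β]

section LeadingTerm

variable (o : TermOrder α κ) {p q : VecPoly α κ β} {c : β} {t : α}

theorem lc_ne_zero (hp : p ≠ 0) : o.lc p ≠ 0 := by
  have h : p.support.Nonempty :=
    Finset.nonempty_iff_ne_empty.2 fun h => hp (DFinsupp.support_eq_empty.1 h)
  rw [lc, lt, dif_pos h]
  exact DFinsupp.mem_support_iff.1 (@Finset.max'_mem _ o.ordTerm p.support h)

theorem mem_supported_atMost_lt (p : VecPoly α κ β) : p ∈ supported β (o.atMost (o.lt p)) := by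
  intro v hv
  have hv' : v ∈ p.support := DFinsupp.mem_support_iff.2 hv
  rw [lt, dif_pos ⟨v, hv'⟩]
  exact @Finset.le_max' _ o.ordTerm p.support v hv'

theorem lt_mem_of_mem_supported {S : Set (α × κ)} (hp : p ∈ supported β S) (h0 : p ≠ 0) :
    o.lt p ∈ S :=
  hp _ (o.lc_ne_zero h0)

theorem lt_smul_monomMult_add (hc : c ≠ 0) (hp : p ≠ 0)
    (hq : q ∈ supported β (o.below (stimes t (o.lt p)))) :
    o.lt (c • monomMult 1 t p + q) = stimes t (o.lt p) := by
  let _ := o.ordTerm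
  have hne : (c • monomMult 1 t p + q) (stimes t (o.lt p)) ≠ 0 := by
    rw [DFinsupp.add_apply, apply_eq_zero_of_mem_supported hq (o.self_notMem_below _),
      add_zero, ← monomMult_eq_smul, monomMult_apply_stimes]
    exact mul_ne_zero hc (o.lc_ne_zero hp)
  have hle : c • monomMult 1 t p + q ∈ supported β (o.atMost (stimes t (o.lt p))) := by
    refine add_mem (Submodule.smul_mem _ _ ?_) (supported_mono (o.below_subset_atMost _) hq)
    exact monomMult_mem_supported (o.mem_supported_atMost_lt p) fun v hv => o.stimes_mono _ _ t hv
  refine le_antisymm (o.lt_mem_of_mem_supported hle fun h => ?_) (o.mem_supported_atMost_lt _ _ hne)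
  exact hne (by rw [h, DFinsupp.zero_apply])

theorem tail_eq_sub (p : VecPoly α κ β) :
    o.tail p = p - DFinsupp.single (o.lt p) (o.lc p) := by
  ext v
  rw [tail, DFinsupp.erase_apply, DFinsupp.sub_apply]
  split_ifs with h
  · rw [h, DFinsupp.single_eq_same, lc, sub_self]
  · rw [DFinsupp.single_eq_of_ne h, sub_zero]

theorem tail_mem_supported {S : Set (α × κ)} (hp : p ∈ supported β S) :
    o.tail p ∈ supported β (S ∩ o.below (o.lt p)) := by
  let _ := o.ordTerm
  intro v hv
  rw [tail, DFinsupp.erase_apply, ite_ne_left_iff] at hv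
  exact ⟨hp v hv.2.symm, (o.mem_supported_atMost_lt p v hv.2.symm).lt_of_ne hv.1⟩

theorem tail_mem_supported_below (p : VecPoly α κ β) :
    o.tail p ∈ supported β (o.below (o.lt p)) :=
  supported_mono Set.inter_subset_right (o.tail_mem_supported (o.mem_supported_atMost_lt p))

end LeadingTerm

/-- The combinations of multiples `t g` with `g ∈ F`, `g ≠ 0` and `t lt(g) ∈ T`. -/
def repSpan (o : TermOrder α κ) (F : Set (VecPoly α κ β)) (T : Set (α × κ)) :
    Submodule β (VecPoly α κ β) :=
  Submodule.span β {m | ∃ t, ∃ g ∈ F, g ≠ 0 ∧ stimes t (o.lt g) ∈ T ∧ monomMult 1 t g = m}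

section Representation

variable {o : TermOrder α κ} {F G : Set (VecPoly α κ β)} {S T : Set (α × κ)} {p : VecPoly α κ β}

theorem monomMult_mem_repSpan (c : β) {t : α} {g : VecPoly α κ β} (hg : g ∈ F) (h0 : g ≠ 0)
    (hT : stimes t (o.lt g) ∈ T) : monomMult c t g ∈ o.repSpan F T := by
  rw [monomMult_eq_smul]
  exact Submodule.smul_mem _ _ (Submodule.subset_span ⟨t, g, hg, h0, hT, rfl⟩)

theorem mem_repSpan_of_mem (hp : p ∈ F) (hT : p ≠ 0 → o.lt p ∈ T) : p ∈ o.repSpan F T := by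
  rcases eq_or_ne p 0 with rfl | h0
  · exact zero_mem _
  · have := monomMult_mem_repSpan 1 hp h0 ((one_stimes (o.lt p)).symm ▸ hT h0)
    rwa [monomMult_one_right, one_smul] at this

theorem repSpan_mono (hFG : F ⊆ G) (hST : S ⊆ T) : o.repSpan F S ≤ o.repSpan G T :=
  Submodule.span_mono fun _ ⟨t, g, hg, h0, hS, hm⟩ => ⟨t, g, hFG hg, h0, hST hS, hm⟩

theorem monomMult_mem_repSpan_of_mem (c : β) {t : α} (hp : p ∈ o.repSpan F S)
    (h : ∀ v ∈ S, stimes t v ∈ T) : monomMult c t p ∈ o.repSpan F T := by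
  suffices o.repSpan F S ≤ (o.repSpan F T).comap (monomMultLinear c t) from this hp
  refine Submodule.span_le.2 ?_
  rintro _ ⟨s, g, hg, h0, hS, rfl⟩
  change monomMult c t (monomMult 1 s g) ∈ o.repSpan F T
  rw [monomMult_monomMult]
  exact monomMult_mem_repSpan _ hg h0 (stimes_stimes t s (o.lt g) ▸ h _ hS)

theorem repSpan_le_pmdlSubmodule : o.repSpan F T ≤ pmdlSubmodule F := by
  refine Submodule.span_le.2 ?_
  rintro _ ⟨t, g, hg, -, -, rfl⟩
  exact .monom 1 t g (.base g hg)

theorem mem_repSpan_univ_of_mem_pmdl (hp : p ∈ pmdl F) : p ∈ o.repSpan F Set.univ := by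
  induction hp with
  | base f hf => exact mem_repSpan_of_mem hf fun _ => trivial
  | zero => exact zero_mem _
  | add p q _ _ hp hq => exact add_mem hp hq
  | monom c t p _ hp => exact monomMult_mem_repSpan_of_mem c hp fun _ _ => trivial

theorem exists_finite_of_mem_repSpan (hp : p ∈ o.repSpan F T) :
    ∃ A ⊆ T, A.Finite ∧ p ∈ o.repSpan F A := by
  induction hp using Submodule.span_induction with
  | mem _ hm =>
    obtain ⟨t, g, hg, h0, hT, rfl⟩ := hm
    exact ⟨{stimes t (o.lt g)}, Set.singleton_subset_iff.2 hT, Set.finite_singleton _,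
      monomMult_mem_repSpan 1 hg h0 rfl⟩
  | zero => exact ⟨∅, Set.empty_subset T, Set.finite_empty, zero_mem _⟩
  | add p q _ _ hp hq =>
    obtain ⟨A, hAT, hA, hp⟩ := hp
    obtain ⟨B, hBT, hB, hq⟩ := hq
    exact ⟨A ∪ B, Set.union_subset hAT hBT, hA.union hB,
      add_mem (repSpan_mono subset_rfl Set.subset_union_left hp)
        (repSpan_mono subset_rfl Set.subset_union_right hq)⟩
  | smul c p _ hp =>
    obtain ⟨A, hAT, hA, hp⟩ := hp
    exact ⟨A, hAT, hA, Submodule.smul_mem _ c hp⟩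

theorem exists_mem_repSpan_atMost (hp : p ∈ o.repSpan F T) (h0 : p ≠ 0) :
    ∃ u ∈ T, p ∈ o.repSpan F (T ∩ o.atMost u) := by
  obtain ⟨A, hAT, hA, hpA⟩ := exists_finite_of_mem_repSpan hp
  have hne : A.Nonempty := by
    refine Set.nonempty_iff_ne_empty.2 ?_
    rintro rfl
    simp [repSpan, h0] at hpA
  let _ := o.ordTerm
  obtain ⟨u, hu, hmax⟩ := Set.exists_max_image A id hA hne
  have hsub : A ⊆ T ∩ o.atMost u := fun v hv => ⟨hAT hv, hmax v hv⟩
  exact ⟨u, hAT hu, repSpan_mono subset_rfl hsub hpA⟩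

end Representation

/-- Reducing a polynomial with terms in `T` by elements of `F` yields only terms in `T`. -/
def RedClosed (o : TermOrder α κ) (F : Set (VecPoly α κ β)) (T : Set (α × κ)) : Prop :=
  ∀ f ∈ F, f ≠ 0 → ∀ t, stimes t (o.lt f) ∈ T → monomMult 1 t f ∈ supported β T

/-- The terms not divisible by the leading term of a non-zero element of `F`. -/
def irredTerms (o : TermOrder α κ) (F : Set (VecPoly α κ β)) : Set (α × κ) :=
  {v | ∀ f ∈ F, f ≠ 0 → ¬ TermDvd (o.lt f) v}

section Reduction

variable {o : TermOrder α κ} {F : Set (VecPoly α κ β)} {S T : Set (α × κ)} {p q : VecPoly α κ β}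

theorem redClosed_univ (o : TermOrder α κ) (F : Set (VecPoly α κ β)) : o.RedClosed F Set.univ :=
  fun _ _ _ _ _ _ _ => trivial

theorem redClosed_below (o : TermOrder α κ) (F : Set (VecPoly α κ β)) (u : α × κ) :
    o.RedClosed F (o.below u) := by
  let _ := o.ordTerm
  exact fun f _ _ t ht => monomMult_mem_supported (o.mem_supported_atMost_lt f)
    fun v hv => (o.stimes_mono _ _ t hv).trans_lt ht

theorem _root_.GroebnerBases.IsDicksonDomain.redClosed (hS : IsDicksonDomain S)
    (hF : ∀ f ∈ F, f ∈ supported β S) : o.RedClosed F S :=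
  fun f hf _ _ ht => monomMult_mem_supported (hF f hf) fun _ hv => hS.stimes_mem ht hv

theorem RedClosed.repSpan_le_supported (hT : o.RedClosed F T) :
    o.repSpan F T ≤ supported β T := by
  refine Submodule.span_le.2 ?_
  rintro _ ⟨t, f, hf, h0, ht, rfl⟩
  exact hT f hf h0 t ht

theorem Red.sub_mem_repSpan (h : o.Red F p q) (hp : p ∈ supported β T) :
    p - q ∈ o.repSpan F T := by
  obtain ⟨f, hf, t, h0, hpt, rfl⟩ := h
  rw [sub_sub_cancel]
  exact monomMult_mem_repSpan _ hf h0 (hp _ hpt)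

theorem RedClosed.sub_mem_repSpan (hT : o.RedClosed F T)
    (h : Relation.ReflTransGen (o.Red F) p q) (hp : p ∈ supported β T) :
    p - q ∈ o.repSpan F T := by
  induction h with
  | refl => exact (sub_self p).symm ▸ zero_mem _
  | tail _ hred ih =>
    have hmid := (Submodule.sub_mem_iff_right _ hp).1 (hT.repSpan_le_supported ih)
    rw [← sub_add_sub_cancel]
    exact add_mem ih (Red.sub_mem_repSpan hred hmid)

theorem RedClosed.mem_supported (hT : o.RedClosed F T)
    (h : Relation.ReflTransGen (o.Red F) p q) (hp : p ∈ supported β T) : q ∈ supported β T :=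
  (Submodule.sub_mem_iff_right _ hp).1 (hT.repSpan_le_supported (hT.sub_mem_repSpan h hp))

theorem sub_mem_pmdlSubmodule_of_reflTransGen_red (h : Relation.ReflTransGen (o.Red F) p q) :
    p - q ∈ pmdlSubmodule F :=
  repSpan_le_pmdlSubmodule ((redClosed_univ o F).sub_mem_repSpan h fun _ _ => trivial)

theorem mem_pmdl_iff_of_reflTransGen_red (h : Relation.ReflTransGen (o.Red F) p q) :
    p ∈ pmdl F ↔ q ∈ pmdl F :=
  have hsub := sub_mem_pmdlSubmodule_of_reflTransGen_red h
  ⟨fun hp => (Submodule.sub_mem_iff_right (pmdlSubmodule F) hp).1 hsub,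
    fun hq => (Submodule.sub_mem_iff_left (pmdlSubmodule F) hq).1 hsub⟩

theorem mem_supported_irredTerms_iff :
    p ∈ supported β (o.irredTerms F) ↔ ¬ ∃ q, o.Red F p q := by
  constructor
  · rintro h ⟨q, f, hf, t, h0, hpt, -⟩
    exact h _ hpt f hf h0 (termDvd_stimes t (o.lt f))
  · intro h v hv f hf h0 hdvd
    exact h ⟨_, f, hf, v.1 / (o.lt f).1, h0, hdvd.stimes_div.symm ▸ hv, rfl⟩

end Reduction

section TotalReduction

variable {o : TermOrder α κ} {fs : List (VecPoly α κ β)} {p f r r' : VecPoly α κ β}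

theorem mem_irredTerms_of_findDvd_eq_none {v : α × κ} (h : o.findDvd fs v = none) :
    v ∈ o.irredTerms {f | f ∈ fs} := by
  induction fs with
  | nil => exact fun f hf => absurd hf List.not_mem_nil
  | cons g fs ih =>
    rw [findDvd] at h
    split_ifs at h with hg
    rintro f (_ | ⟨_, hf⟩) h0 hdvd
    · exact hg ⟨h0, hdvd⟩
    · exact ih h f hf h0 hdvd

theorem of_findDvd_eq_some {v : α × κ} (h : o.findDvd fs v = some f) :
    f ∈ fs ∧ f ≠ 0 ∧ TermDvd (o.lt f) v := by
  induction fs with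
  | nil => cases h
  | cons g fs ih =>
    rw [findDvd] at h
    split_ifs at h with hg
    · cases h
      exact ⟨List.mem_cons_self, hg⟩
    · exact (ih h).imp_left (List.mem_cons_of_mem g)

theorem tail_sub_monomMult_tail (hf : f ≠ 0) (h : TermDvd (o.lt f) (o.lt p)) :
    o.tail p - monomMult (o.lc p / o.lc f) (o.lp p / o.lp f) (o.tail f) =
      p - monomMult (o.lc p / o.lc f) (o.lp p / o.lp f) f := by
  rw [tail_eq_sub, tail_eq_sub, monomMult_sub, monomMult_single, lp, lp, h.stimes_div,
    div_mul_cancel₀ _ (o.lc_ne_zero hf)]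
  abel

theorem tail_sub_monomMult_tail_mem_supported_below (h : TermDvd (o.lt f) (o.lt p)) :
    o.tail p - monomMult (o.lc p / o.lc f) (o.lp p / o.lp f) (o.tail f) ∈
      supported β (o.below (o.lt p)) := by
  refine sub_mem (o.tail_mem_supported_below p)
    (monomMult_mem_supported (o.tail_mem_supported_below f) fun v hv => ?_)
  have := o.stimes_strictMono (o.lp p / o.lp f) hv
  rwa [lp, lp, h.stimes_div] at this

theorem red_tail_sub_monomMult_tail_add (hfs : f ∈ fs) (hf : f ≠ 0)
    (h : TermDvd (o.lt f) (o.lt p)) (hp : p ≠ 0) (hr : r (o.lt p) = 0) :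
    o.Red {f | f ∈ fs} (p + r)
      (o.tail p - monomMult (o.lc p / o.lc f) (o.lp p / o.lp f) (o.tail f) + r) := by
  have hstimes : stimes (o.lp p / o.lp f) (o.lt f) = o.lt p := h.stimes_div
  have hcoeff : (p + r) (o.lt p) = o.lc p := by rw [DFinsupp.add_apply, hr, add_zero, lc]
  refine ⟨f, hfs, o.lp p / o.lp f, hf, ?_, ?_⟩ <;> rw [hstimes, hcoeff]
  · exact o.lc_ne_zero hp
  · rw [tail_sub_monomMult_tail hf h]
    abel

theorem single_lt_mem_supported {S : Set (α × κ)} (h : o.lt p ∈ S) :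
    DFinsupp.single (o.lt p) (o.lc p) ∈ supported β S := fun v hv => by
  rwa [show v = o.lt p from by_contra fun hne => hv (DFinsupp.single_eq_of_ne hne)]

theorem mem_supported_irredTerms_of_trdAux_eq_some (h : o.trdAux fs p r = some r')
    (hr : r ∈ supported β (o.irredTerms {f | f ∈ fs})) :
    r' ∈ supported β (o.irredTerms {f | f ∈ fs}) := by
  refine trdAux.partial_correctness o fs (fun _ r r' =>
    r ∈ supported β (o.irredTerms {f | f ∈ fs}) →
      r' ∈ supported β (o.irredTerms {f | f ∈ fs})) ?_ p r r' h hr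
  intro trdAux' ih p r r' h hr
  split_ifs at h with h0
  · exact Option.some.inj h ▸ hr
  split at h
  case h_1 hf =>
    exact ih _ _ _ h (add_mem hr (single_lt_mem_supported (mem_irredTerms_of_findDvd_eq_none hf)))
  case h_2 => exact ih _ _ _ h hr

theorem reflTransGen_red_of_trdAux_eq_some (h : o.trdAux fs p r = some r')
    (hpr : ∀ w, r w ≠ 0 → p ∈ supported β (o.below w)) :
    Relation.ReflTransGen (o.Red {f | f ∈ fs}) (p + r) r' := by
  refine trdAux.partial_correctness o fs (fun p r r' =>
    (∀ w, r w ≠ 0 → p ∈ supported β (o.below w)) →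
      Relation.ReflTransGen (o.Red {f | f ∈ fs}) (p + r) r') ?_ p r r' h hpr
  clear h hpr
  intro trdAux' ih p r r' h hpr
  let _ := o.ordTerm
  split_ifs at h with h0
  · rw [h0, zero_add, Option.some.inj h]
  have hbelow : ∀ w, r w ≠ 0 → o.lt p < w := fun w hw => hpr w hw _ (o.lc_ne_zero h0)
  have hmono : ∀ {q : VecPoly α κ β}, q ∈ supported β (o.below (o.lt p)) → ∀ w, o.lt p ≤ w →
      q ∈ supported β (o.below w) :=
    fun hq w hw => supported_mono (fun v (hv : v < o.lt p) => hv.trans_le hw) hq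
  split at h
  case h_1 =>
    have hsum : o.tail p + (r + DFinsupp.single (o.lt p) (o.lc p)) = p + r := by
      rw [tail_eq_sub]
      abel
    refine hsum ▸ ih _ _ _ h fun w hw => hmono (o.tail_mem_supported_below p) w ?_
    by_cases hrw : r w = 0
    · rw [DFinsupp.add_apply, hrw, zero_add] at hw
      exact by_contra fun hne => hw (DFinsupp.single_eq_of_ne fun e => hne e.ge)
    · exact (hbelow w hrw).le
  case h_2 f hf =>
    obtain ⟨hfs, hf0, hdvd⟩ := of_findDvd_eq_some hf
    refine .head (red_tail_sub_monomMult_tail_add hfs hf0 hdvd h0 ?_) (ih _ _ _ h fun w hw => ?_)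
    · exact of_not_not fun hr => lt_irrefl _ (hbelow _ hr)
    · exact hmono (tail_sub_monomMult_tail_mem_supported_below hdvd) w (hbelow w hw).le

theorem isNormalForm_of_trd_eq_some (h : o.trd fs p = some r) :
    o.IsNormalForm {f | f ∈ fs} p r := by
  constructor
  · simpa using reflTransGen_red_of_trdAux_eq_some h fun w hw => absurd rfl hw
  · exact mem_supported_irredTerms_iff.1
      (mem_supported_irredTerms_of_trdAux_eq_some h (zero_mem _))

theorem exists_trdAux_eq_some_of_forall_below {S : Set (α × κ)}
    (hS : o.RedClosed {f | f ∈ fs} S) (hp : p ∈ supported β S)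
    (ih : p ≠ 0 → ∀ q ∈ supported β (S ∩ o.below (o.lt p)), ∀ r, ∃ r', o.trdAux fs q r = some r')
    (r : VecPoly α κ β) : ∃ r', o.trdAux fs p r = some r' := by
  rw [trdAux]
  split_ifs with h0
  · exact ⟨r, rfl⟩
  split
  case h_1 => exact ih h0 _ (o.tail_mem_supported hp) _
  case h_2 f hf =>
    obtain ⟨hfs, hf0, hdvd⟩ := of_findDvd_eq_some hf
    refine ih h0 _ (fun v hv => ⟨?_, tail_sub_monomMult_tail_mem_supported_below hdvd v hv⟩) r
    have hstimes : stimes (o.lp p / o.lp f) (o.lt f) = o.lt p := hdvd.stimes_div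
    have hmult := hS f hfs hf0 _ (hstimes ▸ o.lt_mem_of_mem_supported hp h0)
    rw [tail_sub_monomMult_tail hf0 hdvd, monomMult_eq_smul] at hv
    exact sub_mem hp (Submodule.smul_mem _ _ hmult) v hv

theorem exists_trdAux_eq_some {S : Set (α × κ)} (hwf : S.WellFoundedOn o.ordTerm.lt)
    (hS : o.RedClosed {f | f ∈ fs} S) (hp : p ∈ supported β S) (r : VecPoly α κ β) :
    ∃ r', o.trdAux fs p r = some r' := by
  have hbelow : ∀ u ∈ S, ∀ q ∈ supported β (S ∩ o.below u), ∀ r,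
      ∃ r', o.trdAux fs q r = some r' :=
    fun u hu => hwf.induction
      (P := fun u => ∀ q ∈ supported β (S ∩ o.below u), ∀ r, ∃ r', o.trdAux fs q r = some r') hu
      fun u _ ih q hq => exists_trdAux_eq_some_of_forall_below hS
        (supported_mono Set.inter_subset_left hq) fun h0 =>
        have hlt := o.lt_mem_of_mem_supported hq h0
        ih (o.lt q) hlt.1 hlt.2
  exact exists_trdAux_eq_some_of_forall_below hS hp
    (fun h0 => hbelow _ (o.lt_mem_of_mem_supported hp h0)) r

theorem exists_trd_eq_some (o : TermOrder α κ) (fs : List (VecPoly α κ β)) (p : VecPoly α κ β) :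
    ∃ r, o.trd fs p = some r ∧ o.IsNormalForm {f | f ∈ fs} p r := by
  obtain ⟨S, hS, hsupp⟩ := exists_isDicksonDomain_forall_mem_supported
    (List.finite_toSet (p :: fs))
  obtain ⟨hp, hfs⟩ := List.forall_mem_cons.1 hsupp
  obtain ⟨r, hr⟩ := exists_trdAux_eq_some (o.wellFoundedOn_ordTerm_lt hS)
    (hS.redClosed (F := {f | f ∈ fs}) hfs) hp 0
  exact ⟨r, hr, isNormalForm_of_trd_eq_some hr⟩

end TotalReduction

/-- Every non-zero element of the submodule generated by `F` has a leading term divisible by that of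
a non-zero element of `F`. -/
def CoversLeadingTerms (o : TermOrder α κ) (F : Set (VecPoly α κ β)) : Prop :=
  ∀ p ∈ pmdl F, p ≠ 0 → o.lt p ∉ o.irredTerms F

namespace CoversLeadingTerms

variable {o : TermOrder α κ} {F : Set (VecPoly α κ β)} {p r : VecPoly α κ β}

theorem eq_zero (h : o.CoversLeadingTerms F) (hp : p ∈ pmdl F)
    (hirred : p ∈ supported β (o.irredTerms F)) : p = 0 :=
  by_contra fun h0 => h p hp h0 (o.lt_mem_of_mem_supported hirred h0)

theorem mem_pmdl_iff (h : o.CoversLeadingTerms F) (hr : o.IsNormalForm F p r) :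
    p ∈ pmdl F ↔ r = 0 := by
  rw [mem_pmdl_iff_of_reflTransGen_red hr.1]
  exact ⟨fun hmem => h.eq_zero hmem (mem_supported_irredTerms_iff.2 hr.2), fun h0 => h0 ▸ .zero⟩

theorem isNormalForm_unique (h : o.CoversLeadingTerms F) {r' : VecPoly α κ β}
    (hr : o.IsNormalForm F p r) (hr' : o.IsNormalForm F p r') : r = r' := by
  refine sub_eq_zero.1 (h.eq_zero ?_
    (sub_mem (mem_supported_irredTerms_iff.2 hr.2) (mem_supported_irredTerms_iff.2 hr'.2)))
  rw [← mem_pmdlSubmodule, ← sub_sub_sub_cancel_left]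
  exact sub_mem (sub_mem_pmdlSubmodule_of_reflTransGen_red hr'.1)
    (sub_mem_pmdlSubmodule_of_reflTransGen_red hr.1)

theorem isGB {fs : List (VecPoly α κ β)} (h : o.CoversLeadingTerms {f | f ∈ fs}) :
    o.IsGB {f | f ∈ fs} := by
  intro a b c hab hac
  obtain ⟨b', -, hb'⟩ := o.exists_trd_eq_some fs b
  obtain ⟨c', -, hc'⟩ := o.exists_trd_eq_some fs c
  have heq : b' = c' := h.isNormalForm_unique ⟨hab.trans hb'.1, hb'.2⟩ ⟨hac.trans hc'.1, hc'.2⟩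
  exact ⟨b', hb'.1, heq ▸ hc'.1⟩

end CoversLeadingTerms

section SPolynomials

variable {o : TermOrder α κ} {F : Set (VecPoly α κ β)} {S : Set (α × κ)} {p q : VecPoly α κ β}

theorem spoly_eq_zero_of_ne (h : (o.lt p).2 ≠ (o.lt q).2) : o.spoly p q = 0 :=
  if_neg h

theorem spoly_eq_sub (h : (o.lt p).2 = (o.lt q).2) : o.spoly p q =
    monomMult (1 / o.lc p) ((lcmTerm (o.lt p) (o.lt q)).1 / (o.lt p).1) p -
      monomMult (1 / o.lc q) ((lcmTerm (o.lt p) (o.lt q)).1 / (o.lt q).1) q :=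
  if_pos h

theorem spoly_self (o : TermOrder α κ) (p : VecPoly α κ β) : o.spoly p p = 0 :=
  (spoly_eq_sub rfl).trans (sub_self _)

theorem spoly_comm (o : TermOrder α κ) (p q : VecPoly α κ β) : o.spoly p q = -o.spoly q p := by
  by_cases h : (o.lt p).2 = (o.lt q).2
  · rw [spoly_eq_sub h, spoly_eq_sub h.symm, lcmTerm_comm h, neg_sub]
  · rw [spoly_eq_zero_of_ne h, spoly_eq_zero_of_ne (Ne.symm h), neg_zero]

theorem spoly_mem_pmdlSubmodule (hp : p ∈ F) (hq : q ∈ F) : o.spoly p q ∈ pmdlSubmodule F := by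
  by_cases h : (o.lt p).2 = (o.lt q).2
  · rw [spoly_eq_sub h]
    exact sub_mem (.monom _ _ p (.base p hp)) (.monom _ _ q (.base q hq))
  · exact spoly_eq_zero_of_ne h ▸ zero_mem _

theorem lcmTerm_lt_zero_right (h : (o.lt p).2 = (o.lt (0 : VecPoly α κ β)).2) :
    lcmTerm (o.lt p) (o.lt (0 : VecPoly α κ β)) = o.lt p := by
  let _ := o.ordTerm
  have hzero : o.lt (0 : VecPoly α κ β) = (1, ⊥) := dif_neg (by simp)
  have hdvd : TermDvd (o.lt (0 : VecPoly α κ β)) (o.lt p) := ⟨h.symm, hzero ▸ one_dvd _⟩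
  exact le_antisymm (o.ordTerm_le_of_termDvd (lcmTerm_dvd ⟨rfl, dvd_rfl⟩ hdvd))
    (o.ordTerm_le_of_termDvd (termDvd_lcmTerm_left _ _))

theorem monomMult_lcmTerm_div_mem_supported (hS : IsDicksonDomain S) (hp : p ∈ supported β S)
    (hq : q ∈ supported β S) (h : (o.lt p).2 = (o.lt q).2) (c : β) :
    monomMult c ((lcmTerm (o.lt p) (o.lt q)).1 / (o.lt p).1) p ∈ supported β S := by
  rcases eq_or_ne p 0 with rfl | hp0
  · simp [monomMult]
  have hpS := o.lt_mem_of_mem_supported hp hp0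
  have hlcm : lcmTerm (o.lt p) (o.lt q) ∈ S := by
    rcases eq_or_ne q 0 with rfl | hq0
    · rwa [lcmTerm_lt_zero_right h]
    · exact hS.lcmTerm_mem hpS (o.lt_mem_of_mem_supported hq hq0)
  rw [← (termDvd_lcmTerm_left (o.lt p) (o.lt q)).stimes_div] at hlcm
  exact monomMult_mem_supported hp fun v hv => hS.stimes_mem hlcm hv

theorem spoly_mem_supported (hS : IsDicksonDomain S) (hp : p ∈ supported β S)
    (hq : q ∈ supported β S) : o.spoly p q ∈ supported β S := by
  by_cases h : (o.lt p).2 = (o.lt q).2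
  · rw [spoly_eq_sub h]
    refine sub_mem (monomMult_lcmTerm_div_mem_supported hS hp hq h _) ?_
    rw [lcmTerm_comm h]
    exact monomMult_lcmTerm_div_mem_supported hS hq hp h.symm _
  · exact spoly_eq_zero_of_ne h ▸ zero_mem _

theorem monomMult_sub_single_mem_supported_below {t : α} {u : α × κ} (hp : p ≠ 0)
    (h : stimes t (o.lt p) = u) :
    monomMult (1 / o.lc p) t p - DFinsupp.single u 1 ∈ supported β (o.below u) := by
  have htail : monomMult (1 / o.lc p) t p - DFinsupp.single u 1 =
      monomMult (1 / o.lc p) t (o.tail p) := by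
    rw [tail_eq_sub, monomMult_sub, monomMult_single, one_div_mul_cancel (o.lc_ne_zero hp), h]
  rw [htail, ← h]
  exact monomMult_mem_supported (o.tail_mem_supported_below p) fun _ => o.stimes_strictMono t

theorem spoly_mem_supported_below_lcmTerm (hp : p ≠ 0) (hq : q ≠ 0) :
    o.spoly p q ∈ supported β (o.below (lcmTerm (o.lt p) (o.lt q))) := by
  by_cases h : (o.lt p).2 = (o.lt q).2
  · rw [spoly_eq_sub h, ← sub_sub_sub_cancel_right]
    exact sub_mem
      (monomMult_sub_single_mem_supported_below hp (termDvd_lcmTerm_left _ _).stimes_div)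
      (monomMult_sub_single_mem_supported_below hq (termDvd_lcmTerm_right h).stimes_div)
  · exact spoly_eq_zero_of_ne h ▸ zero_mem _

theorem exists_monomMult_eq_add_spoly {s t : α} (hp : p ≠ 0)
    (h : stimes s (o.lt p) = stimes t (o.lt q)) :
    ∃ a, stimes a (lcmTerm (o.lt p) (o.lt q)) = stimes s (o.lt p) ∧ monomMult 1 s p =
      (o.lc p / o.lc q) • monomMult 1 t q + o.lc p • monomMult 1 a (o.spoly p q) := by
  have hcomp : (o.lt p).2 = (o.lt q).2 := (congrArg Prod.snd h :)
  obtain ⟨a, ha⟩ : ∃ a, stimes a (lcmTerm (o.lt p) (o.lt q)) = stimes s (o.lt p) :=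
    ⟨_, (lcmTerm_dvd (termDvd_stimes s _) (h ▸ termDvd_stimes t _)).stimes_div⟩
  have hs : a * ((lcmTerm (o.lt p) (o.lt q)).1 / (o.lt p).1) = s :=
    stimes_left_injective (o.lt p) <| by
      beta_reduce
      rw [← stimes_stimes, (termDvd_lcmTerm_left _ _).stimes_div, ha]
  have ht : a * ((lcmTerm (o.lt p) (o.lt q)).1 / (o.lt q).1) = t :=
    stimes_left_injective (o.lt q) <| by
      beta_reduce
      rw [← stimes_stimes, (termDvd_lcmTerm_right hcomp).stimes_div, ha, h]
  refine ⟨a, ha, ?_⟩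
  rw [spoly_eq_sub hcomp, monomMult_sub, monomMult_monomMult, monomMult_monomMult, hs, ht,
    one_mul, one_mul, monomMult_eq_smul (1 / _), monomMult_eq_smul (1 / _) t, smul_sub, smul_smul,
    smul_smul, mul_one_div_cancel (o.lc_ne_zero hp), one_smul, mul_one_div, add_sub_cancel]

end SPolynomials

/-- The S-polynomial of `p` and `q`, if both are non-zero, is representable in terms of `F` strictly
below the least common multiple of the leading terms of `p` and `q`. -/
def SpolyRep (o : TermOrder α κ) (F : Set (VecPoly α κ β)) (p q : VecPoly α κ β) : Prop :=
  p ≠ 0 → q ≠ 0 → o.spoly p q ∈ o.repSpan F (o.below (lcmTerm (o.lt p) (o.lt q)))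

section BuchbergerCriterion

variable {o : TermOrder α κ} {F G : Set (VecPoly α κ β)} {S : Set (α × κ)}
  {p q : VecPoly α κ β}

theorem SpolyRep.refl (o : TermOrder α κ) (F : Set (VecPoly α κ β)) (p : VecPoly α κ β) :
    o.SpolyRep F p p :=
  fun _ _ => spoly_self o p ▸ zero_mem _

theorem SpolyRep.symm (h : o.SpolyRep F p q) : o.SpolyRep F q p := by
  intro hq hp
  by_cases hcomp : (o.lt p).2 = (o.lt q).2
  · rw [spoly_comm, ← lcmTerm_comm hcomp]
    exact neg_mem (h hp hq)
  · exact spoly_eq_zero_of_ne (Ne.symm hcomp) ▸ zero_mem _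

theorem SpolyRep.mono (hFG : F ⊆ G) (h : o.SpolyRep F p q) : o.SpolyRep G p q :=
  fun hp hq => repSpan_mono hFG subset_rfl (h hp hq)

theorem exists_isDicksonDomain_spoly_mem_repSpan (hF : F.Finite)
    (h : ∀ p ∈ F, ∀ q ∈ F, o.SpolyRep F p q) {A : Set (α × κ)} (hA : A.Finite) :
    ∃ S, IsDicksonDomain S ∧ A ⊆ S ∧ ∀ p ∈ F, ∀ q ∈ F, p ≠ 0 → q ≠ 0 →
      o.spoly p q ∈ o.repSpan F (S ∩ o.below (lcmTerm (o.lt p) (o.lt q))) := by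
  have hrep : ∀ x ∈ F ×ˢ F, ∃ B : Set (α × κ), B.Finite ∧ (x.1 ≠ 0 → x.2 ≠ 0 →
      o.spoly x.1 x.2 ∈ o.repSpan F (B ∩ o.below (lcmTerm (o.lt x.1) (o.lt x.2)))) := by
    rintro ⟨p, q⟩ ⟨hp, hq⟩
    by_cases h0 : p ≠ 0 ∧ q ≠ 0
    · obtain ⟨B, hBT, hB, hmem⟩ := exists_finite_of_mem_repSpan (h p hp q hq h0.1 h0.2)
      exact ⟨B, hB, fun _ _ => (Set.inter_eq_left.2 hBT).symm ▸ hmem⟩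
    · exact ⟨∅, Set.finite_empty, fun hp0 hq0 => absurd ⟨hp0, hq0⟩ h0⟩
  choose! B hB hmem using hrep
  obtain ⟨S, hS, hsub⟩ := exists_isDicksonDomain_superset (hA.union ((hF.prod hF).biUnion hB))
  refine ⟨S, hS, Set.subset_union_left.trans hsub, fun p hp q hq hp0 hq0 => ?_⟩
  have hBS : B (p, q) ⊆ S :=
    (Set.subset_biUnion_of_mem (Set.mk_mem_prod hp hq)).trans (Set.subset_union_right.trans hsub)
  exact repSpan_mono subset_rfl (Set.inter_subset_inter_left _ hBS)
    (hmem (p, q) ⟨hp, hq⟩ hp0 hq0)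

theorem repSpan_atMost_stimes_lt_le (hS : IsDicksonDomain S)
    (h : ∀ p ∈ F, ∀ q ∈ F, p ≠ 0 → q ≠ 0 →
      o.spoly p q ∈ o.repSpan F (S ∩ o.below (lcmTerm (o.lt p) (o.lt q))))
    {t : α} {g : VecPoly α κ β} (hg : g ∈ F) (hg0 : g ≠ 0) :
    o.repSpan F (S ∩ o.atMost (stimes t (o.lt g))) ≤
      Submodule.span β {monomMult 1 t g} ⊔ o.repSpan F (S ∩ o.below (stimes t (o.lt g))) := by
  let _ := o.ordTerm
  refine Submodule.span_le.2 ?_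
  rintro _ ⟨s, f, hf, hf0, ⟨hfS, hle⟩, rfl⟩
  rcases lt_or_eq_of_le hle with hlt | heq
  · exact Submodule.mem_sup_right (monomMult_mem_repSpan _ hf hf0 ⟨hfS, hlt⟩)
  obtain ⟨a, ha, hdecomp⟩ := exists_monomMult_eq_add_spoly hf0 heq
  rw [SetLike.mem_coe, hdecomp]
  refine Submodule.add_mem_sup
    (Submodule.smul_mem _ _ (Submodule.mem_span_singleton_self _)) (Submodule.smul_mem _ _ ?_)
  refine monomMult_mem_repSpan_of_mem 1 (h f hf g hg hf0 hg0) fun v hv => ⟨?_, ?_⟩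
  · exact hS.stimes_mem (ha.symm ▸ hfS) hv.1
  · exact heq ▸ ha ▸ o.stimes_strictMono a hv.2

theorem mem_repSpan_below_of_lt_mem_irredTerms (hS : IsDicksonDomain S)
    (h : ∀ p ∈ F, ∀ q ∈ F, p ≠ 0 → q ≠ 0 →
      o.spoly p q ∈ o.repSpan F (S ∩ o.below (lcmTerm (o.lt p) (o.lt q))))
    {u : α × κ} (hp : p ∈ o.repSpan F (S ∩ o.atMost u)) (hirred : o.lt p ∈ o.irredTerms F) :
    p ∈ o.repSpan F (S ∩ o.below u) := by
  let _ := o.ordTerm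
  by_cases hgen : ∃ t, ∃ g ∈ F, g ≠ 0 ∧ stimes t (o.lt g) = u
  · obtain ⟨t, g, hg, hg0, rfl⟩ := hgen
    obtain ⟨m, hm, q, hq, rfl⟩ :=
      Submodule.mem_sup.1 (repSpan_atMost_stimes_lt_le hS h hg hg0 hp)
    obtain ⟨c, rfl⟩ := Submodule.mem_span_singleton.1 hm
    rcases eq_or_ne c 0 with rfl | hc
    · rwa [zero_smul, zero_add]
    have hqbelow : q ∈ supported β (o.below (stimes t (o.lt g))) :=
      (redClosed_below o F _).repSpan_le_supported
        (repSpan_mono subset_rfl Set.inter_subset_right hq)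
    rw [o.lt_smul_monomMult_add hc hg0 hqbelow] at hirred
    exact absurd (termDvd_stimes t (o.lt g)) (hirred g hg hg0)
  · refine Submodule.span_mono ?_ hp
    rintro _ ⟨t, g, hg, hg0, ⟨hgS, hle⟩, rfl⟩
    exact ⟨t, g, hg, hg0, ⟨hgS, hle.lt_of_ne fun e => hgen ⟨t, g, hg, hg0, e⟩⟩, rfl⟩

theorem coversLeadingTerms_of_spolyRep (hF : F.Finite)
    (h : ∀ p ∈ F, ∀ q ∈ F, o.SpolyRep F p q) : o.CoversLeadingTerms F := by
  intro p hp h0 hirred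
  obtain ⟨A, -, hA, hpA⟩ := exists_finite_of_mem_repSpan (mem_repSpan_univ_of_mem_pmdl (o := o) hp)
  obtain ⟨S, hS, hAS, hspoly⟩ := exists_isDicksonDomain_spoly_mem_repSpan hF h hA
  have hdescend : ∀ u ∈ S, p ∉ o.repSpan F (S ∩ o.below u) := fun u hu =>
    (o.wellFoundedOn_ordTerm_lt hS).induction (P := fun u => p ∉ o.repSpan F (S ∩ o.below u)) hu
      fun u _ ih hpu => by
        obtain ⟨w, ⟨hwS, hwu⟩, hpw⟩ := exists_mem_repSpan_atMost hpu h0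
        have hpw' := repSpan_mono subset_rfl
          (Set.inter_subset_inter_left _ Set.inter_subset_left) hpw
        exact ih w hwS hwu (mem_repSpan_below_of_lt_mem_irredTerms hS hspoly hpw' hirred)
  obtain ⟨u, hu, hpu⟩ := exists_mem_repSpan_atMost (repSpan_mono subset_rfl hAS hpA) h0
  exact hdescend u hu (mem_repSpan_below_of_lt_mem_irredTerms hS hspoly hpu hirred)

end BuchbergerCriterion

end TermOrder

section Pairs

variable {γ : Type*}

theorem mem_and_mem_of_mem_listPairs {l : List γ} {x : γ × γ} (hx : x ∈ listPairs l) :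
    x.1 ∈ l ∧ x.2 ∈ l := by
  induction l with
  | nil => exact absurd hx List.not_mem_nil
  | cons a l ih =>
    rcases List.mem_append.1 hx with hx | hx
    · obtain ⟨b, hb, rfl⟩ := List.mem_map.1 hx
      exact ⟨List.mem_cons_self, List.mem_cons_of_mem _ hb⟩
    · exact (ih hx).imp (List.mem_cons_of_mem _) (List.mem_cons_of_mem _)

theorem mem_listPairs_or_swap_mem {l : List γ} {p q : γ} (hp : p ∈ l) (hq : q ∈ l) (h : p ≠ q) :
    (p, q) ∈ listPairs l ∨ (q, p) ∈ listPairs l := by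
  induction l with
  | nil => exact absurd hp List.not_mem_nil
  | cons a l ih =>
    simp only [listPairs, List.mem_append, List.mem_map, Prod.mk.injEq]
    rcases List.mem_cons.1 hp with rfl | hp' <;> rcases List.mem_cons.1 hq with rfl | hq'
    · exact absurd rfl h
    · exact .inl (.inl ⟨q, hq', rfl, rfl⟩)
    · exact .inr (.inl ⟨p, hp', rfl, rfl⟩)
    · exact (ih hp' hq').imp .inr .inr

variable [DecidableEq γ]

theorem mem_diffList_singleton {l : List γ} {x y : γ} : y ∈ diffList l [x] ↔ y ∈ l ∧ y ≠ x := by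
  simp [diffList]

theorem length_diffList_lt {l : List γ} {x : γ} (hx : x ∈ l) :
    (diffList l [x]).length < l.length := by
  rw [diffList, List.length_filter_lt_length_iff_exists]
  exact ⟨x, hx, by simp⟩

theorem addPairs_nil_nil (l : List γ) : addPairs [] [] l = listPairs l.dedup := by
  simp [addPairs, List.product]

theorem addPairs_nil_right (bs : List γ) (ps : List (γ × γ)) : addPairs bs ps [] = ps := by
  simp [addPairs, listPairs, List.product]

theorem mem_addPairs_singleton {bs : List γ} {ps : List (γ × γ)} {h : γ} {x : γ × γ} :
    x ∈ addPairs bs ps [h] ↔ x ∈ ps ∨ x.1 = h ∧ x.2 ∈ bs := by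
  simp [addPairs, listPairs, List.product, Prod.ext_iff, and_comm, eq_comm]

end Pairs

namespace TermOrder

variable {α κ β : Type*} [GradedDicksonPowerprod α] [DecidableEq α] [LinearOrder κ] [OrderBot κ]
  [Field β] [DecidableEq β]

/-- The pair of `p` and `q` is still to be considered, in one of its two orders, or its S-polynomial
is representable as in Buchberger's criterion. -/
def PairHandled (o : TermOrder α κ) (ps : List (VecPoly α κ β × VecPoly α κ β))
    (F : Set (VecPoly α κ β)) (p q : VecPoly α κ β) : Prop :=
  (p, q) ∈ ps ∨ (q, p) ∈ ps ∨ o.SpolyRep F p q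

/-- The loop invariant of Buchberger's algorithm: `bs` is the current basis, `ps` the list of pairs
still to be considered, and all terms lie in `S`. -/
structure BuchbergerInvariant (o : TermOrder α κ) (S : Set (α × κ)) (bs : List (VecPoly α κ β))
    (ps : List (VecPoly α κ β × VecPoly α κ β)) : Prop where
  mem_supported : ∀ b ∈ bs, b ∈ supported β S
  mem_and_mem : ∀ x ∈ ps, x.1 ∈ bs ∧ x.2 ∈ bs
  pairHandled : ∀ p ∈ bs, ∀ q ∈ bs, o.PairHandled ps {b | b ∈ bs} p q

/-- `bs'` extends `bs` by a non-zero polynomial whose leading term lies in `S` and is not divisible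
by the leading terms of `bs`. -/
def Extends (o : TermOrder α κ) (S : Set (α × κ)) (bs' bs : List (VecPoly α κ β)) : Prop :=
  ∃ r, bs' = bs ++ [r] ∧ r ≠ 0 ∧ o.lt r ∈ S ∧ o.lt r ∈ o.irredTerms {b | b ∈ bs}

section Buchberger

variable {o : TermOrder α κ} {S : Set (α × κ)} {F G : Set (VecPoly α κ β)}
  {fs bs : List (VecPoly α κ β)} {ps : List (VecPoly α κ β × VecPoly α κ β)}
  {a b p q r : VecPoly α κ β}

theorem coversLeadingTerms_of_genWholeModule (h : o.genWholeModule bs = true) :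
    o.CoversLeadingTerms {b | b ∈ bs} := by
  intro p hp h0 hirred
  obtain ⟨f, hf, w, hw, hcomp⟩ := exists_component_of_mem_pmdl hp (o.lc_ne_zero h0)
  rw [genWholeModule, List.all_eq_true] at h
  obtain ⟨b, hb, hb0, hlt⟩ := of_decide_eq_true (h f hf) w (DFinsupp.mem_support_iff.2 hw)
  refine hirred b hb hb0 ?_
  rw [hlt]
  exact ⟨hcomp, one_dvd _⟩

theorem spolyRep_of_reflTransGen_red (hred : Relation.ReflTransGen (o.Red F) (o.spoly p q) r)
    (hFG : F ⊆ G) (hr : r ≠ 0 → r ∈ G) : o.SpolyRep G p q := by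
  intro hp hq
  have hbelow := spoly_mem_supported_below_lcmTerm (o := o) hp hq
  have hclosed := redClosed_below o F (lcmTerm (o.lt p) (o.lt q))
  rw [← sub_add_cancel (o.spoly p q) r]
  refine add_mem (repSpan_mono hFG subset_rfl (hclosed.sub_mem_repSpan hred hbelow)) ?_
  rcases eq_or_ne r 0 with rfl | hr0
  · exact zero_mem _
  · exact mem_repSpan_of_mem (hr hr0) (o.lt_mem_of_mem_supported
      (hclosed.mem_supported hred hbelow))

theorem PairHandled.diffList (h : o.PairHandled ps F a b) (hFG : F ⊆ G)
    (hpq : o.SpolyRep G p q) : o.PairHandled (diffList ps [(p, q)]) G a b := by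
  simp only [PairHandled, mem_diffList_singleton]
  by_cases hab : (a, b) = (p, q)
  · obtain ⟨rfl, rfl⟩ := Prod.mk.inj hab
    exact .inr (.inr hpq)
  by_cases hba : (b, a) = (p, q)
  · obtain ⟨rfl, rfl⟩ := Prod.mk.inj hba
    exact .inr (.inr hpq.symm)
  exact h.imp (⟨·, hab⟩) (.imp (⟨·, hba⟩) (.mono hFG))

namespace BuchbergerInvariant

theorem init (hfs : ∀ f ∈ fs, f ∈ supported β S) :
    o.BuchbergerInvariant S fs (addPairs [] [] fs) where
  mem_supported := hfs
  mem_and_mem x hx := by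
    rw [addPairs_nil_nil] at hx
    exact (mem_and_mem_of_mem_listPairs hx).imp List.mem_dedup.1 List.mem_dedup.1
  pairHandled p hp q hq := by
    rcases eq_or_ne p q with rfl | hpq
    · exact .inr (.inr (.refl o _ p))
    · rw [addPairs_nil_nil, PairHandled, ← or_assoc]
      exact .inl (mem_listPairs_or_swap_mem (List.mem_dedup.2 hp) (List.mem_dedup.2 hq) hpq)

theorem coversLeadingTerms (h : o.BuchbergerInvariant S bs []) :
    o.CoversLeadingTerms {b | b ∈ bs} :=
  coversLeadingTerms_of_spolyRep (List.finite_toSet bs) fun p hp q hq => by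
    simpa only [PairHandled, List.not_mem_nil, false_or] using h.pairHandled p hp q hq

theorem mem_supported_of_reflTransGen_red (h : o.BuchbergerInvariant S bs ps)
    (hS : IsDicksonDomain S) (hpq : (p, q) ∈ ps)
    (hred : Relation.ReflTransGen (o.Red {b | b ∈ bs}) (o.spoly p q) r) : r ∈ supported β S :=
  have ⟨hp, hq⟩ := h.mem_and_mem _ hpq
  (hS.redClosed h.mem_supported).mem_supported hred
    (spoly_mem_supported hS (h.mem_supported p hp) (h.mem_supported q hq))

theorem discard (h : o.BuchbergerInvariant S bs ps)
    (hred : Relation.ReflTransGen (o.Red {b | b ∈ bs}) (o.spoly p q) 0) :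
    o.BuchbergerInvariant S bs (diffList ps [(p, q)]) where
  mem_supported := h.mem_supported
  mem_and_mem x hx := h.mem_and_mem x (mem_diffList_singleton.1 hx).1
  pairHandled a ha b hb := (h.pairHandled a ha b hb).diffList subset_rfl
    (spolyRep_of_reflTransGen_red hred subset_rfl fun h0 => absurd rfl h0)

theorem extend (h : o.BuchbergerInvariant S bs ps)
    (hred : Relation.ReflTransGen (o.Red {b | b ∈ bs}) (o.spoly p q) r)
    (hr : r ∈ supported β S) :
    o.BuchbergerInvariant S (bs ++ [r]) (addPairs bs (diffList ps [(p, q)]) [r]) := by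
  have hsub : {b | b ∈ bs} ⊆ {b | b ∈ bs ++ [r]} := fun b hb => List.mem_append_left _ hb
  have hmem : r ∈ bs ++ [r] := List.mem_append_right _ (List.mem_singleton_self r)
  have hcases : ∀ b ∈ bs ++ [r], b ∈ bs ∨ b = r := fun b hb => by simpa using hb
  refine ⟨fun b hb => ?_, fun x hx => ?_, fun a ha b hb => ?_⟩
  · rcases hcases b hb with hb | rfl
    exacts [h.mem_supported b hb, hr]
  · rcases mem_addPairs_singleton.1 hx with hx | ⟨hx₁, hx₂⟩
    · exact (h.mem_and_mem x (mem_diffList_singleton.1 hx).1).imp (hsub ·) (hsub ·)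
    · exact ⟨hx₁ ▸ hmem, hsub hx₂⟩
  · simp only [PairHandled, mem_addPairs_singleton]
    rcases hcases a ha with ha' | rfl <;> rcases hcases b hb with hb' | rfl
    · exact ((h.pairHandled a ha' b hb').diffList hsub
        (spolyRep_of_reflTransGen_red hred hsub fun _ => hmem)).imp .inl (.imp .inl id)
    · exact .inr (.inl (.inr ⟨rfl, ha'⟩))
    · exact .inl (.inr ⟨rfl, hb'⟩)
    · exact .inr (.inr (.refl o _ _))

end BuchbergerInvariant

theorem wellFounded_extends (o : TermOrder α κ) (hS : IsDicksonDomain S) :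
    WellFounded (o.Extends S : List (VecPoly α κ β) → List (VecPoly α κ β) → Prop) := by
  refine wellFounded_iff_isEmpty_descending_chain.2 ⟨fun ⟨f, hf⟩ => ?_⟩
  choose r hr h0 hrS hirred using hf
  have hmono : Monotone fun i => {b | b ∈ f i} := monotone_nat_of_le_succ fun i b hb =>
    (hr i).symm ▸ List.mem_append_left _ hb
  obtain ⟨i, j, hij, hdvd⟩ := hS.partiallyWellOrderedOn.exists_lt hrS
  have hi : r i ∈ f (i + 1) := (hr i).symm ▸ List.mem_append_right _ (List.mem_singleton_self _)
  exact hirred j (r i) (hmono (Nat.succ_le_of_lt hij) hi) (h0 i) hdvd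

variable {sel : List (VecPoly α κ β) → List (VecPoly α κ β × VecPoly α κ β) →
  List (VecPoly α κ β × VecPoly α κ β)}

theorem exists_gbSchemaAux_eq (o : TermOrder α κ) (hsel : SelectsSinglePair sel) (hps : ps ≠ [])
    (hbs : ¬ o.genWholeModule bs = true) : ∃ p q r, (p, q) ∈ ps ∧
      o.IsNormalForm {b | b ∈ bs} (o.spoly p q) r ∧ o.gbSchemaAux sel o.gbRed bs ps =
        if r = 0 then o.gbSchemaAux sel o.gbRed bs (diffList ps [(p, q)])
        else o.gbSchemaAux sel o.gbRed (bs ++ [r]) (addPairs bs (diffList ps [(p, q)]) [r]) := by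
  obtain ⟨⟨p, q⟩, hpq, hselect⟩ := hsel bs ps hps
  obtain ⟨r, hr, hnf⟩ := o.exists_trd_eq_some bs (o.spoly p q)
  refine ⟨p, q, r, hpq, hnf, ?_⟩
  rw [gbSchemaAux, if_neg (not_or_intro hps hbs), hselect]
  split_ifs with h0 <;> simp [gbRed, hr, h0, addPairs_nil_right]

theorem BuchbergerInvariant.exists_gbSchemaAux_eq_some (h : o.BuchbergerInvariant S bs ps)
    (hS : IsDicksonDomain S) (hsel : SelectsSinglePair sel) :
    ∃ G, o.gbSchemaAux sel o.gbRed bs ps = some G ∧ o.CoversLeadingTerms {g | g ∈ G} ∧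
      pmdl {g | g ∈ G} = pmdl {b | b ∈ bs} := by
  induction bs using (o.wellFounded_extends (β := β) hS).induction generalizing ps with
  | _ bs ihbs =>
  induction hlen : ps.length using Nat.strong_induction_on generalizing ps with
  | _ n ihps =>
  by_cases hps : ps = []
  · subst hps
    exact ⟨bs, by rw [gbSchemaAux, if_pos (.inl rfl)], h.coversLeadingTerms, rfl⟩
  by_cases hbs : o.genWholeModule bs = true
  · exact ⟨bs, by rw [gbSchemaAux, if_pos (.inr hbs)],
      coversLeadingTerms_of_genWholeModule hbs, rfl⟩
  obtain ⟨p, q, r, hpq, ⟨hred, hirred⟩, heq⟩ := o.exists_gbSchemaAux_eq hsel hps hbs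
  rw [heq]
  split_ifs with h0
  · exact ihps _ (hlen ▸ length_diffList_lt hpq) (h.discard (h0 ▸ hred)) rfl
  · have hrS := h.mem_supported_of_reflTransGen_red hS hpq hred
    have hrirred := o.lt_mem_of_mem_supported (mem_supported_irredTerms_iff.2 hirred) h0
    have ⟨hp, hq⟩ := h.mem_and_mem _ hpq
    have hrmem := (mem_pmdl_iff_of_reflTransGen_red hred).1 (spoly_mem_pmdlSubmodule hp hq)
    have hset : {b | b ∈ bs ++ [r]} = insert r {b | b ∈ bs} := Set.ext fun b => by simp [or_comm]
    rw [← pmdl_insert hrmem, ← hset]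
    exact ihbs _ ⟨r, rfl, h0, o.lt_mem_of_mem_supported hrS h0, hrirred⟩ (h.extend hred hrS)

theorem exists_gb_eq_some (o : TermOrder α κ) (hsel : SelectsSinglePair sel)
    (fs : List (VecPoly α κ β)) :
    ∃ G, o.gb sel fs = some G ∧ o.CoversLeadingTerms {g | g ∈ G} ∧
      pmdl {g | g ∈ G} = pmdl {f | f ∈ fs} := by
  obtain ⟨S, hS, hfs⟩ := exists_isDicksonDomain_forall_mem_supported (List.finite_toSet fs)
  exact (BuchbergerInvariant.init hfs).exists_gbSchemaAux_eq_some hS hsel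

end Buchberger

end TermOrder

end GroebnerBases

theorem mainTheorem7_general {α κ β : Type*} [GradedDicksonPowerprod α] [DecidableEq α]
    [LinearOrder κ] [OrderBot κ] [Field β] [DecidableEq β]
    (o : GroebnerBases.TermOrder α κ)
    (sel : List (GroebnerBases.VecPoly α κ β) →
      List (GroebnerBases.VecPoly α κ β × GroebnerBases.VecPoly α κ β) →
      List (GroebnerBases.VecPoly α κ β × GroebnerBases.VecPoly α κ β))
    (hsel : GroebnerBases.SelectsSinglePair sel)
    (fs : List (GroebnerBases.VecPoly α κ β)) :
    (∃ G : List (GroebnerBases.VecPoly α κ β), o.gb sel fs = some G ∧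
      o.IsGB {g | g ∈ G} ∧
      GroebnerBases.pmdl {g | g ∈ G} = GroebnerBases.pmdl {f | f ∈ fs} ∧
      ∀ p : GroebnerBases.VecPoly α κ β, ∃ r : GroebnerBases.VecPoly α κ β,
        o.trd G p = some r ∧ o.IsNormalForm {g | g ∈ G} p r ∧
        (p ∈ GroebnerBases.pmdl {f | f ∈ fs} ↔ r = 0)) ∧
    ∀ p : GroebnerBases.VecPoly α κ β, ∃ b : Bool,
      o.memTest sel fs p = some b ∧ (b = true ↔ p ∈ GroebnerBases.pmdl {f | f ∈ fs}) := by
  obtain ⟨G, hG, hcovers, hpmdl⟩ := o.exists_gb_eq_some hsel fs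
  have htrd : ∀ p : GroebnerBases.VecPoly α κ β, ∃ r : GroebnerBases.VecPoly α κ β,
      o.trd G p = some r ∧ o.IsNormalForm {g | g ∈ G} p r ∧
        (p ∈ GroebnerBases.pmdl {f | f ∈ fs} ↔ r = 0) := fun p => by
    obtain ⟨r, hr, hnf⟩ := o.exists_trd_eq_some G p
    exact ⟨r, hr, hnf, hpmdl ▸ hcovers.mem_pmdl_iff hnf⟩
  refine ⟨⟨G, hG, hcovers.isGB, hpmdl, htrd⟩, fun p => ?_⟩
  obtain ⟨r, hr, -, hmem⟩ := htrd p
  exact ⟨decide (r = 0), by simp [GroebnerBases.TermOrder.memTest, hG, hr],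
    decide_eq_true_iff.trans hmem.symm⟩

theorem mainTheorem7 {α κ β : Type*} [GradedDicksonPowerprod α] [DecidableEq α]
    [LinearOrder κ] [OrderBot κ] [WellFoundedLT κ] [Field β] [DecidableEq β]
    (o : GroebnerBases.TermOrder α κ)
    (sel : List (GroebnerBases.VecPoly α κ β) →
      List (GroebnerBases.VecPoly α κ β × GroebnerBases.VecPoly α κ β) →
      List (GroebnerBases.VecPoly α κ β × GroebnerBases.VecPoly α κ β))
    (hsel : GroebnerBases.SelectsSinglePair sel)
    (fs : List (GroebnerBases.VecPoly α κ β)) :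
    -- `gb` terminates on `fs`; its result `G` is a Gröbner basis of the submodule generated by `fs`
    (∃ G : List (GroebnerBases.VecPoly α κ β), o.gb sel fs = some G ∧
      o.IsGB {g | g ∈ G} ∧
      GroebnerBases.pmdl {g | g ∈ G} = GroebnerBases.pmdl {f | f ∈ fs} ∧
      -- `trd` terminates on `G` and `p` with a normal form `r` of `p` modulo `G`
      ∀ p : GroebnerBases.VecPoly α κ β, ∃ r : GroebnerBases.VecPoly α κ β,
        o.trd G p = some r ∧ o.IsNormalForm {g | g ∈ G} p r ∧
        (p ∈ GroebnerBases.pmdl {f | f ∈ fs} ↔ r = 0)) ∧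
    -- hence membership is decided by the (always terminating) membership test
    ∀ p : GroebnerBases.VecPoly α κ β, ∃ b : Bool,
      o.memTest sel fs p = some b ∧ (b = true ↔ p ∈ GroebnerBases.pmdl {f | f ∈ fs}) :=
  mainTheorem7_general o sel hsel fs
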